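/- Fix integers $p$ (the number of groups) and $d$ (the size of each group), a quantile index $\tau\in(0,1)$ and $\gamma>0$; put $r=dp$ and write a vector $\beta\in\mathbb{R}^r$ as $\beta=(\beta_1,\dots,\beta_p)$ with $\beta_j\in\mathbb{R}^d$. Norms are Euclidean. Consider the linear model $$Y_i=\sum_{j=1}^p X_{ij}^t\beta^0_j+\varepsilon_i=\mathbb{X}_i^t\beta^0+\varepsilon_i,\qquad i=1,2,\dots,$$ with deterministic design vectors $\mathbb{X}_i\in\mathbb{R}^r$ and true parameter $\beta^0\in\mathbb{R}^r$, under the following assumptions. (A1) The errors $\varepsilon_i$ are i.i.d. with distribution function $F$ and density $f$; $f$ is continuous and strictly positive in a neighbourhood of $0$; and $F(0)=\tau$. (A2) There are constants $0<m_0\le M_0<\infty$ such that, for all sufficiently large $n$, all eigenvalues of $n^{-1}\sum_{i=1}^n\mathbb{X}_i\mathbb{X}_i^t$ lie in $[m_0,M_0]$. (A3) $(p/n)^{1/2}\max_{1\le i\le n}\|\mathbb{X}_i\|\to 0$ as $n\to\infty$. The nonnegative tuning parameters $\mu_n^{(1)},\mu_n^{(2)}$ satisfy, for $m=1,2$ and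 $n\to\infty$, $\mu_n^{(m)}\to\infty$, $n^{-1/2}\mu_n^{(m)}\to0$ and $n^{(\gamma-1)/2}\mu_n^{(m)}\to\infty$. Let $\rho_\tau(u)=u(\tau-1_{u<0})$ and $G_n(\beta)=\sum_{i=1}^n\rho_\tau(Y_i-\mathbb{X}_i^t\beta)$, let the quantile estimator $\widetilde\beta_n$ be a (measurable) minimizer of $G_n$ over $\mathbb{R}^r$, and let the adaptive fused group LASSO quantile estimator $\widehat\beta_n$ be a (measurable) minimizer over $\mathbb{R}^r$ of $$Q_n(\beta)=G_n(\beta)+\mu_n^{(1)}\sum_{j=1}^p\|\widetilde\beta_{n;j}\|^{-\gamma}\|\beta_j\|+\mu_n^{(2)}\sum_{j=2}^p\|\widetilde\beta_{n;j}-\widetilde\beta_{n;j-1}\|^{-\gamma}\|\beta_j-\beta_{j-1}\|,$$ where $0^{-\gamma}=\infty$ and $\infty\cdot 0=0$. Let $\mathcal{A}=\{j:\|\beta^0_j\|\ne0\}$ and $\widehat{\mathcal{A}}_n=\{j:\|\widehat\beta_{n;j}\|\neq0\}$. Then $$\lim_{n\to\infty}\mathbb{P}\big[\widehat{\mathcal{A}}_n=\mathcal{A}\big]=1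 .$$ -/

import Mathlib

open MeasureTheory ProbabilityTheory Filter Topology
open scoped NNReal ENNReal RealInnerProductSpace

noncomputable section

/-- Vectors of `ℝ^r`, `r = d p`, divided into `p` groups of size `d`. The norm and the inner product
are the Euclidean ones of `ℝ^r`, and `v j` is the `j`-th group, with the Euclidean norm of `ℝ^d`. -/
abbrev GroupedVec (p d : ℕ) : Type := PiLp 2 fun _ : Fin p => EuclideanSpace ℝ (Fin d)

/-- The check function `ρ_τ(u) = u (τ - 1_{u < 0})`. -/
def checkFunction (τ u : ℝ) : ℝ := u * (τ - if u < 0 then 1 else 0)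

/-- The quantile process `G_n(β) = ∑ ρ_τ(Y_i - X_iᵗ β)` of the first `n` observations
(observations are numbered from `0`). -/
def quantileProcess {p d : ℕ} (τ : ℝ) (X : ℕ → GroupedVec p d) (y : ℕ → ℝ) (n : ℕ)
    (β : GroupedVec p d) : ℝ :=
  ∑ i ∈ Finset.range n, checkFunction τ (y i - ⟪X i, β⟫)

/-- The adaptive weight `‖v‖ ^ (-γ)`; it is `∞` at `v = 0`. -/
def adaptiveWeight {d : ℕ} (γ : ℝ) (v : EuclideanSpace ℝ (Fin d)) : ℝ≥0∞ := ‖v‖ₑ ^ (-γ)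

/-- The penalized process `Q_n`, with pilot vector `b` in the adaptive weights and tuning
parameters `μ₁`, `μ₂`. The second sum runs over the pairs of successive groups. All terms are
nonnegative; a term with infinite weight is `0` if its norm is `0` and `∞` otherwise
(for a positive tuning parameter). -/
def penalizedProcess {p d : ℕ} (τ γ : ℝ) (X : ℕ → GroupedVec p d) (y : ℕ → ℝ) (n : ℕ)
    (μ₁ μ₂ : ℝ≥0) (b β : GroupedVec p d) : ℝ≥0∞ :=
  ENNReal.ofReal (quantileProcess τ X y n β)
    + μ₁ * ∑ j : Fin p, adaptiveWeight γ (b j) * ‖β j‖ₑ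
    + μ₂ * ∑ q : Fin p × Fin p with q.1.val + 1 = q.2.val,
        adaptiveWeight γ (b q.2 - b q.1) * ‖β q.2 - β q.1‖ₑ

/-- The set of the groups of `β` that do not vanish. -/
def activeGroups {p d : ℕ} (β : GroupedVec p d) : Set (Fin p) := {j | ‖β j‖ ≠ 0}

/-- The normalized Gram matrix `n⁻¹ ∑ X_i X_iᵗ` of the first `n` observations. -/
def gramMatrix {p d : ℕ} (X : ℕ → GroupedVec p d) (n : ℕ) :
    Matrix (Fin p × Fin d) (Fin p × Fin d) ℝ :=
  (n : ℝ)⁻¹ • ∑ i ∈ Finset.range n,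
    Matrix.vecMulVec (fun a => X i a.1 a.2) (fun a => X i a.1 a.2)

/-- Assumption on the errors: i.i.d. with a common density `f`, which is continuous and strictly
positive in a neighbourhood of `0`, and with distribution function `F` such that `F(0) = τ`. -/
structure ErrorAssumption {Ω : Type*} [MeasurableSpace Ω] (P : Measure Ω) (τ : ℝ)
    (ε : ℕ → Ω → ℝ) (f : ℝ → ℝ) : Prop where
  measurable : ∀ i, Measurable (ε i)
  indep : iIndepFun ε P
  density_measurable : Measurable f
  density_nonneg : ∀ x, 0 ≤ f x
  law : ∀ i, P.map (ε i) = volume.withDensity fun x => ENNReal.ofReal (f x)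
  density_continuous : ∀ᶠ x in 𝓝 (0 : ℝ), ContinuousAt f x
  density_pos : ∀ᶠ x in 𝓝 (0 : ℝ), 0 < f x
  quantile : ∀ i, cdf (P.map (ε i)) 0 = τ

/-- Assumption on the design: the eigenvalues of the normalized Gram matrix are bounded away from
`0` and from `∞` (for `n` large: the matrix is singular when `n < r`), and
`(p/n)^{1/2} max_{i ≤ n} ‖X_i‖ → 0`. -/
structure DesignAssumption {p d : ℕ} (X : ℕ → GroupedVec p d) : Prop where
  eigenvalues : ∃ m₀ M₀ : ℝ, 0 < m₀ ∧ m₀ ≤ M₀ ∧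
    ∀ᶠ n : ℕ in atTop, spectrum ℝ (gramMatrix X n) ⊆ Set.Icc m₀ M₀
  max_norm : Tendsto (fun n : ℕ => ((p : ℝ) / n) ^ (1 / 2 : ℝ) * ⨆ i : Fin n, ‖X i‖) atTop (𝓝 0)

/-- The conditions on a sequence of tuning parameters. -/
structure TuningCondition (γ : ℝ) (μ : ℕ → ℝ≥0) : Prop where
  tendsto_atTop : Tendsto (fun n => (μ n : ℝ)) atTop atTop
  small : Tendsto (fun n : ℕ => (n : ℝ) ^ (-(1 / 2) : ℝ) * μ n) atTop (𝓝 0)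
  large : Tendsto (fun n : ℕ => (n : ℝ) ^ ((γ - 1) / 2) * μ n) atTop atTop

end

/-! Put u = √n (β - β₀) and x_i = X_i / √n. By Knight's identity (`checkFunction_sub`) the increment
of G_n is a linear term -⟪W, u⟫ plus a sum of nonnegative remainders. W is bounded in probability
because the scores are independent and centred. For fixed u and large n, the remainder sum has mean
at least a multiple of ‖u‖², since the density is positive near 0 and the Gram matrix is bounded
below, and it has small variance, since max ‖x_i‖ → 0. Hence (`exists_local_event`), with
probability close to 1, the increment exceeds K on a sphere of fixed radius K and is L-Lipschitz on
the ball.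

On that event the argument is deterministic (`activeGroups_eq_of_local`). By convexity, every u
where the increment is at most ‖u‖ lies in the ball. This covers the pilot, and also the penalized
minimizer β: the weights of the truly nonzero groups and differences are bounded, so moving from β
to β₀ raises the penalty by O((μ₁ + μ₂) ‖β - β₀‖), which is at most ‖u‖ as the μ's are o(√n). Both
estimators are thus within K/√n of β₀, and active groups stay nonzero. Setting the truly inactive
groups of β to zero would save at least μ₁ (K/√n)^(-γ), of order √n · n^((γ-1)/2) μ₁, per unit of
displacement, and cost at most √n L + O(μ₂). The saving dominates, so minimality forces these groups
to vanish already. -/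

/-! ### Check function and Knight's identity -/

/-- The score `ψ_τ(e) = τ - 1_{e < 0}` of the check function. -/
noncomputable def score (τ e : ℝ) : ℝ := τ - if e < 0 then 1 else 0

/-- The remainder in Knight's identity `ρ_τ(e - t) = ρ_τ(e) - t ψ_τ(e) + R(e, t)`. -/
noncomputable def knightRemainder (e t : ℝ) : ℝ := if e < 0 then max (e - t) 0 else max (t - e) 0

lemma checkFunction_sub (τ e t : ℝ) :
    checkFunction τ (e - t) = checkFunction τ e - t * score τ e + knightRemainder e t := by
  unfold checkFunction score knightRemainder
  rcases lt_or_ge e 0 with he | he <;> rcases lt_or_ge (e - t) 0 with h | h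
  · rw [if_pos he, if_pos he, if_pos h, max_eq_right h.le]; ring
  · rw [if_pos he, if_pos he, if_neg h.not_gt, max_eq_left h]; ring
  · rw [if_neg he.not_gt, if_neg he.not_gt, if_pos h, max_eq_left (by linarith)]; ring
  · rw [if_neg he.not_gt, if_neg he.not_gt, if_neg h.not_gt, max_eq_right (by linarith)]; ring

lemma checkFunction_nonneg {τ : ℝ} (hτ : τ ∈ Set.Ioo (0 : ℝ) 1) (u : ℝ) :
    0 ≤ checkFunction τ u := by
  unfold checkFunction
  split_ifs with h
  · nlinarith [hτ.2]
  · nlinarith [hτ.1]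

lemma checkFunction_eq_max {τ : ℝ} (u : ℝ) :
    checkFunction τ u = τ * u + max (-u) 0 := by
  unfold checkFunction
  split_ifs with h
  · rw [max_eq_left (by linarith)]; ring
  · rw [max_eq_right (by linarith)]; ring

lemma convexOn_checkFunction (τ : ℝ) : ConvexOn ℝ Set.univ (checkFunction τ) := by
  have h : checkFunction τ = fun u => τ * u + max (-u) 0 := funext fun u => checkFunction_eq_max u
  rw [h]
  refine ConvexOn.add ?_ (ConvexOn.sup ?_ ?_)
  · exact (LinearMap.mulLeft ℝ τ).convexOn convex_univ
  · exact (-(LinearMap.id : ℝ →ₗ[ℝ] ℝ)).convexOn convex_univ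
  · exact convexOn_const 0 convex_univ

lemma abs_score_le_one {τ : ℝ} (hτ : τ ∈ Set.Ioo (0 : ℝ) 1) (e : ℝ) : |score τ e| ≤ 1 := by
  unfold score
  rw [abs_le]
  split_ifs <;> constructor <;> linarith [hτ.1, hτ.2]

lemma measurable_score (τ : ℝ) : Measurable (score τ) := by
  unfold score
  exact measurable_const.sub (Measurable.ite measurableSet_Iio measurable_const measurable_const)

lemma measurable_knightRemainder (t : ℝ) : Measurable fun e => knightRemainder e t := by
  unfold knightRemainder
  exact Measurable.ite measurableSet_Iio (by fun_prop) (by fun_prop)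

lemma knightRemainder_zero (e : ℝ) : knightRemainder e 0 = 0 := by
  unfold knightRemainder
  split_ifs with h
  · exact max_eq_right (by linarith)
  · exact max_eq_right (by linarith)

lemma knightRemainder_nonneg (e t : ℝ) : 0 ≤ knightRemainder e t := by
  unfold knightRemainder
  split_ifs <;> exact le_max_right _ _

/-- The remainder is 1-Lipschitz in the increment and vanishes when the increment is at most |e| in
size, so only errors in [-T, T] contribute. This localization gains a factor T in expectation. -/
lemma abs_knightRemainder_sub_le {e s t T : ℝ} (hs : |s| ≤ T) (ht : |t| ≤ T) :
    |knightRemainder e s - knightRemainder e t|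
      ≤ |s - t| * Set.indicator (Set.Icc (-T) T) 1 e := by
  rw [abs_le] at hs ht
  by_cases he : e ∈ Set.Icc (-T) T
  · rw [Set.indicator_of_mem he, Pi.one_apply, mul_one]
    unfold knightRemainder
    split_ifs
    · refine (abs_max_sub_max_le_abs _ _ _).trans (le_of_eq ?_)
      rw [← abs_neg]; congr 1; ring
    · refine (abs_max_sub_max_le_abs _ _ _).trans (le_of_eq ?_)
      congr 1; ring
  · rw [Set.indicator_of_notMem he, mul_zero]
    have h : e < -T ∨ T < e := by
      by_contra! hc
      exact he hc
    unfold knightRemainder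
    split_ifs with h0
    · have : e < -T := by rcases h with h | h <;> linarith
      rw [max_eq_right (by linarith), max_eq_right (by linarith)]; simp
    · have : T < e := by rcases h with h | h <;> linarith
      rw [max_eq_right (by linarith), max_eq_right (by linarith)]; simp

lemma knightRemainder_le {e t : ℝ} :
    knightRemainder e t ≤ |t| * Set.indicator (Set.Icc (-|t|) |t|) 1 e := by
  have h := abs_knightRemainder_sub_le (e := e) (s := t) (t := 0) le_rfl
    (by simp : |(0 : ℝ)| ≤ |t|)
  rw [knightRemainder_zero, sub_zero, sub_zero] at h
  exact (le_abs_self _).trans h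

/-- An error between 0 and t/2 leaves at least t/2 of the overshoot t - e. For t < 0 the interval is
empty and the bound is trivial. -/
lemma knightRemainder_ge_right (e t : ℝ) :
    t / 2 * Set.indicator (Set.Icc 0 (t / 2)) 1 e ≤ knightRemainder e t := by
  by_cases he : e ∈ Set.Icc 0 (t / 2)
  · rw [Set.indicator_of_mem he]
    unfold knightRemainder
    rw [if_neg he.1.not_gt]
    refine le_trans ?_ (le_max_left _ _)
    simp only [Pi.one_apply]
    linarith [he.2]
  · rw [Set.indicator_of_notMem he, mul_zero]
    exact knightRemainder_nonneg _ _

lemma knightRemainder_ge_left (e t : ℝ) :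
    -t / 2 * Set.indicator (Set.Ico (t / 2) 0) 1 e ≤ knightRemainder e t := by
  by_cases he : e ∈ Set.Ico (t / 2) 0
  · rw [Set.indicator_of_mem he]
    unfold knightRemainder
    rw [if_pos he.2]
    refine le_trans ?_ (le_max_left _ _)
    simp only [Pi.one_apply]
    linarith [he.1]
  · rw [Set.indicator_of_notMem he, mul_zero]
    exact knightRemainder_nonneg _ _

/-! ### Error law near the origin and moments of the remainder -/

lemma integral_score_eq_zero {ν : Measure ℝ} [IsProbabilityMeasure ν] {τ : ℝ} (h0 : ν {0} = 0)
    (h : cdf ν 0 = τ) : ∫ e, score τ e ∂ν = 0 := by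
  have h1 : ν.real (Set.Iio 0) = τ := by
    rw [← h, cdf_eq_real]
    exact measureReal_congr (Iio_ae_eq_Iic' h0)
  have h2 : (fun e : ℝ => if e < 0 then (1 : ℝ) else 0) = Set.indicator (Set.Iio 0) 1 := by
    ext e; simp [Set.indicator_apply]
  have h3 : Integrable (fun e : ℝ => if e < 0 then (1 : ℝ) else 0) ν := by
    rw [h2]
    exact (integrable_const (1 : ℝ)).indicator measurableSet_Iio
  unfold score
  rw [integral_sub (integrable_const _) h3, h2, integral_indicator_one measurableSet_Iio, h1]
  simp

/-- Linear lower and upper bounds, with constants `c` and `C`, on the mass that `ν` gives to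
the intervals of length at most `δ` at the origin. -/
structure LinearMassAtZero (ν : Measure ℝ) (c C δ : ℝ) : Prop where
  right : ∀ s, 0 ≤ s → s ≤ δ → c * s ≤ ν.real (Set.Icc 0 s)
  left : ∀ s, 0 ≤ s → s ≤ δ → c * s ≤ ν.real (Set.Ico (-s) 0)
  upper : ∀ s, 0 ≤ s → s ≤ δ → ν.real (Set.Icc (-s) s) ≤ C * s

lemma withDensity_linearMassAtZero {f : ℝ → ℝ} (hc : ContinuousAt f 0) (hpos : 0 < f 0)
    [IsProbabilityMeasure (volume.withDensity fun x => ENNReal.ofReal (f x))] :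
    ∃ c C δ : ℝ, 0 < c ∧ 0 < C ∧ 0 < δ ∧
      LinearMassAtZero (volume.withDensity fun x => ENNReal.ofReal (f x)) c C δ := by
  set ν := volume.withDensity fun x => ENNReal.ofReal (f x)
  have hlo : ∀ᶠ x in 𝓝 (0 : ℝ), f 0 / 2 < f x := hc.eventually_const_lt (by linarith)
  have hhi : ∀ᶠ x in 𝓝 (0 : ℝ), f x < 2 * f 0 := hc.eventually_lt_const (by linarith)
  obtain ⟨δ, hδ, hball⟩ := Metric.eventually_nhds_iff.1 (hlo.and hhi)
  have hb : ∀ x, -(δ / 2) ≤ x → x ≤ δ / 2 → f 0 / 2 ≤ f x ∧ f x ≤ 2 * f 0 := by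
    intro x h1 h2
    have := hball (y := x) (by rw [Real.dist_eq, sub_zero, abs_lt]; constructor <;> linarith)
    exact ⟨this.1.le, this.2.le⟩
  have lower : ∀ (s : Set ℝ), MeasurableSet s → s ⊆ Set.Icc (-(δ / 2)) (δ / 2) → ∀ l : ℝ,
      volume s = ENNReal.ofReal l → 0 ≤ l → f 0 / 2 * l ≤ ν.real s := by
    intro s hs hsub l hl hl0
    rw [measureReal_def, ← ENNReal.ofReal_le_iff_le_toReal (measure_ne_top _ _)]
    rw [withDensity_apply _ hs, ENNReal.ofReal_mul (by linarith), ← hl, ← setLIntegral_const]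
    refine setLIntegral_mono' hs fun x hx => ENNReal.ofReal_le_ofReal (hb x ?_ ?_).1
    · exact (hsub hx).1
    · exact (hsub hx).2
  -- The density lies between f(0)/2 and 2 f(0); the last factor 2 comes from the length 2s of [-s,
  -- s].
  refine ⟨f 0 / 2, 2 * f 0 * 2, δ / 2, by linarith, by linarith, by linarith, ?_, ?_, ?_⟩
  · intro s h0 h1
    refine lower _ measurableSet_Icc (Set.Icc_subset_Icc (by linarith) h1) s ?_ h0
    rw [Real.volume_Icc, sub_zero]
  · intro s h0 h1
    refine lower _ measurableSet_Ico
      (Set.Ico_subset_Icc_self.trans (Set.Icc_subset_Icc (by linarith) (by linarith))) s ?_ h0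
    rw [Real.volume_Ico]; congr 1; ring
  · intro s h0 h1
    rw [measureReal_def]
    refine ENNReal.toReal_le_of_le_ofReal (by nlinarith) ?_
    rw [withDensity_apply _ measurableSet_Icc, mul_assoc, ENNReal.ofReal_mul (by linarith)]
    have hv : ENNReal.ofReal (2 * s) = volume (Set.Icc (-s) s) := by
      rw [Real.volume_Icc]; congr 1; ring
    rw [hv, ← setLIntegral_const]
    refine setLIntegral_mono' measurableSet_Icc fun x hx => ENNReal.ofReal_le_ofReal (hb x ?_ ?_).2
    · linarith [hx.1]
    · linarith [hx.2]

lemma integrable_indicator_one {ν : Measure ℝ} [IsFiniteMeasure ν] {s : Set ℝ}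
    (hs : MeasurableSet s) : Integrable (Set.indicator s (1 : ℝ → ℝ)) ν :=
  (integrable_const (1 : ℝ)).indicator hs

lemma memLp_knightRemainder (ν : Measure ℝ) [IsFiniteMeasure ν] (t : ℝ) (q : ℝ≥0∞) :
    MemLp (fun e => knightRemainder e t) q ν := by
  refine MemLp.of_bound (measurable_knightRemainder t).aestronglyMeasurable |t|
    (ae_of_all _ fun e => ?_)
  rw [Real.norm_of_nonneg (knightRemainder_nonneg e t)]
  refine knightRemainder_le.trans (mul_le_of_le_one_right (abs_nonneg t) ?_)
  exact Set.indicator_le_self' (fun _ _ => zero_le_one) e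

/-- A remainder of at least |t|/2 on a set of mass at least c |t|/2. -/
lemma le_integral_knightRemainder {ν : Measure ℝ} [IsFiniteMeasure ν] {c C δ t : ℝ}
    (h : LinearMassAtZero ν c C δ) (ht : |t| ≤ δ) :
    c / 4 * t ^ 2 ≤ ∫ e, knightRemainder e t ∂ν := by
  have hint : Integrable (fun e => knightRemainder e t) ν :=
    (memLp_knightRemainder ν t 1).integrable le_rfl
  rcases le_total 0 t with h0 | h0
  · rw [abs_of_nonneg h0] at ht
    have h1 := h.right (t / 2) (by linarith) (by linarith)
    have h2 := integral_mono ((integrable_indicator_one (ν := ν)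
      (measurableSet_Icc (a := (0 : ℝ)) (b := t / 2))).const_mul (t / 2)) hint
      (fun e => knightRemainder_ge_right e t)
    rw [integral_const_mul, integral_indicator_one measurableSet_Icc] at h2
    nlinarith [mul_le_mul_of_nonneg_left h1 (by linarith : 0 ≤ t / 2)]
  · rw [abs_of_nonpos h0] at ht
    have h1 := h.left (-t / 2) (by linarith) (by linarith)
    rw [show -(-t / 2) = t / 2 by ring] at h1
    have h2 := integral_mono ((integrable_indicator_one (ν := ν)
      (measurableSet_Ico (a := t / 2) (b := (0 : ℝ)))).const_mul (-t / 2)) hint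
      (fun e => knightRemainder_ge_left e t)
    rw [integral_const_mul, integral_indicator_one measurableSet_Ico] at h2
    nlinarith [mul_le_mul_of_nonneg_left h1 (by linarith : 0 ≤ -t / 2)]

/-- The square is at most t² and lives on |e| ≤ |t|, of mass at most C |t|. The third factor |t|
makes the total variance small for small increments. -/
lemma integral_knightRemainder_sq_le {ν : Measure ℝ} [IsFiniteMeasure ν] {c C δ t : ℝ}
    (h : LinearMassAtZero ν c C δ) (ht : |t| ≤ δ) :
    ∫ e, knightRemainder e t ^ 2 ∂ν ≤ C * |t| * t ^ 2 := by
  have h2 := integral_mono (μ := ν) (memLp_knightRemainder ν t 2).integrable_sq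
    ((integrable_indicator_one (ν := ν)
      (measurableSet_Icc (a := -|t|) (b := |t|))).const_mul (t ^ 2)) (fun e => by
        refine (pow_le_pow_left₀ (knightRemainder_nonneg e t) knightRemainder_le 2).trans ?_
        rw [mul_pow, sq_abs]
        refine mul_le_mul_of_nonneg_left (le_of_eq ?_) (sq_nonneg t)
        by_cases he : e ∈ Set.Icc (-|t|) |t| <;> simp [he])
  rw [integral_const_mul, integral_indicator_one measurableSet_Icc] at h2
  nlinarith [mul_le_mul_of_nonneg_left (h.upper |t| (abs_nonneg t) ht) (sq_nonneg t)]

/-! ### The local process and its decomposition -/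

/-- The sum `∑_{i < n} ψ_τ(e_i) x_i`, the negative gradient at `0` of the local process. -/
noncomputable def scoreSum {E : Type*} [NormedAddCommGroup E] [InnerProductSpace ℝ E]
    (τ : ℝ) (x : ℕ → E) (e : ℕ → ℝ) (n : ℕ) : E :=
  ∑ i ∈ Finset.range n, score τ (e i) • x i

/-- The sum of the Knight remainders at the increments `⟪x_i, u⟫`. -/
noncomputable def remainderSum {E : Type*} [NormedAddCommGroup E] [InnerProductSpace ℝ E]
    (x : ℕ → E) (e : ℕ → ℝ) (n : ℕ) (u : E) : ℝ :=
  ∑ i ∈ Finset.range n, knightRemainder (e i) ⟪x i, u⟫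

/-- A Lipschitz constant of the sum of the Knight remainders on the ball of radius `K`. -/
noncomputable def remainderModulus {E : Type*} [NormedAddCommGroup E] [InnerProductSpace ℝ E]
    (x : ℕ → E) (e : ℕ → ℝ) (n : ℕ) (K : ℝ) : ℝ :=
  ∑ i ∈ Finset.range n, ‖x i‖ * Set.indicator (Set.Icc (-(K * ‖x i‖)) (K * ‖x i‖)) 1 (e i)

/-- The centred quantile process `∑_{i < n} (ρ_τ(e_i - ⟪x_i, u⟫) - ρ_τ(e_i))`. -/
noncomputable def localProcess {E : Type*} [NormedAddCommGroup E] [InnerProductSpace ℝ E]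
    (τ : ℝ) (x : ℕ → E) (e : ℕ → ℝ) (n : ℕ) (u : E) : ℝ :=
  ∑ i ∈ Finset.range n, (checkFunction τ (e i - ⟪x i, u⟫) - checkFunction τ (e i))

section Deterministic

variable {E : Type*} [NormedAddCommGroup E] [InnerProductSpace ℝ E]

lemma localProcess_eq (τ : ℝ) (x : ℕ → E) (e : ℕ → ℝ) (n : ℕ) (u : E) :
    localProcess τ x e n u = -⟪scoreSum τ x e n, u⟫ + remainderSum x e n u := by
  unfold localProcess scoreSum remainderSum
  rw [sum_inner, ← Finset.sum_neg_distrib, ← Finset.sum_add_distrib]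
  refine Finset.sum_congr rfl fun i _ => ?_
  rw [checkFunction_sub, real_inner_smul_left]
  ring

lemma abs_remainderSum_sub_le (x : ℕ → E) (e : ℕ → ℝ) (n : ℕ) {K : ℝ} {u v : E}
    (hu : ‖u‖ ≤ K) (hv : ‖v‖ ≤ K) :
    |remainderSum x e n u - remainderSum x e n v| ≤ remainderModulus x e n K * ‖u - v‖ := by
  unfold remainderSum remainderModulus
  rw [← Finset.sum_sub_distrib, Finset.sum_mul]
  refine (Finset.abs_sum_le_sum_abs _ _).trans (Finset.sum_le_sum fun i _ => ?_)
  have hb : ∀ w : E, ‖w‖ ≤ K → |⟪x i, w⟫| ≤ K * ‖x i‖ := fun w hw =>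
    (abs_real_inner_le_norm _ _).trans (by rw [mul_comm]; gcongr)
  refine (abs_knightRemainder_sub_le (hb u hu) (hb v hv)).trans ?_
  rw [← inner_sub_right, mul_right_comm]
  refine mul_le_mul_of_nonneg_right (abs_real_inner_le_norm _ _) ?_
  exact Set.indicator_nonneg (fun _ _ => zero_le_one) _

end Deterministic

/-! ### Stochastic bounds on the local process -/

section Probability

variable {E : Type*} [NormedAddCommGroup E] [InnerProductSpace ℝ E]
  {Ω : Type*} [MeasurableSpace Ω] {P : Measure Ω} [IsProbabilityMeasure P]
  {ε : ℕ → Ω → ℝ} {ν : Measure ℝ} {τ c C δ : ℝ}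

lemma integral_score_mul_score (hτ : τ ∈ Set.Ioo (0 : ℝ) 1) (hmeas : ∀ i, Measurable (ε i))
    (hindep : iIndepFun ε P) (hlaw : ∀ i, P.map (ε i) = ν) (hscore : ∫ e, score τ e ∂ν = 0)
    (i j : ℕ) (a : ℝ) :
    Integrable (fun ω => score τ (ε i ω) * score τ (ε j ω) * a) P ∧
      (i ≠ j → ∫ ω, score τ (ε i ω) * score τ (ε j ω) * a ∂P = 0) := by
  have hm : ∀ i, Measurable fun ω => score τ (ε i ω) := fun i => (measurable_score τ).comp (hmeas i)
  constructor
  · refine Integrable.mul_const ?_ a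
    refine Integrable.of_bound ((hm i).mul (hm j)).aestronglyMeasurable 1 (ae_of_all _ fun ω => ?_)
    rw [norm_mul]
    exact mul_le_one₀ (abs_score_le_one hτ _) (norm_nonneg _) (abs_score_le_one hτ _)
  · intro hij
    have h0 : ∫ ω, score τ (ε i ω) ∂P = 0 := by
      rw [← hscore, ← hlaw i, integral_map (hmeas i).aemeasurable
        (measurable_score τ).aestronglyMeasurable]
    have hi : IndepFun (fun ω => score τ (ε i ω)) (fun ω => score τ (ε j ω)) P :=
      (hindep.indepFun hij).comp (measurable_score τ) (measurable_score τ)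
    rw [integral_mul_const, hi.integral_fun_mul_eq_mul_integral (hm i).aestronglyMeasurable
      (hm j).aestronglyMeasurable, h0, zero_mul, zero_mul]

lemma norm_scoreSum_sq (x : ℕ → E) (e : ℕ → ℝ) (n : ℕ) :
    ‖scoreSum τ x e n‖ ^ 2 = ∑ i ∈ Finset.range n, ∑ j ∈ Finset.range n,
      score τ (e i) * score τ (e j) * ⟪x i, x j⟫ := by
  rw [← real_inner_self_eq_norm_sq, scoreSum, sum_inner]
  refine Finset.sum_congr rfl fun i _ => ?_
  rw [inner_sum]
  refine Finset.sum_congr rfl fun j _ => ?_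
  rw [real_inner_smul_left, real_inner_smul_right]
  ring

/-- Markov's inequality for the squared norm: independence and centring remove the cross terms, and
each squared score is at most 1. -/
lemma measureReal_norm_scoreSum_ge (hτ : τ ∈ Set.Ioo (0 : ℝ) 1) (hmeas : ∀ i, Measurable (ε i))
    (hindep : iIndepFun ε P) (hlaw : ∀ i, P.map (ε i) = ν) (hscore : ∫ e, score τ e ∂ν = 0)
    (x : ℕ → E) (n : ℕ) {B : ℝ} (hB : 0 < B) :
    P.real {ω | B ≤ ‖scoreSum τ x (fun i => ε i ω) n‖}
      ≤ (∑ i ∈ Finset.range n, ‖x i‖ ^ 2) / B ^ 2 := by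
  have hint := fun i j =>
    integral_score_mul_score hτ hmeas hindep hlaw hscore i j ⟪x i, x j⟫
  have hI : Integrable (fun ω => ‖scoreSum τ x (fun i => ε i ω) n‖ ^ 2) P := by
    simp only [norm_scoreSum_sq]
    exact integrable_finsetSum _ fun i _ => integrable_finsetSum _ fun j _ => (hint i j).1
  have hE : ∫ ω, ‖scoreSum τ x (fun i => ε i ω) n‖ ^ 2 ∂P ≤ ∑ i ∈ Finset.range n, ‖x i‖ ^ 2 := by
    simp only [norm_scoreSum_sq]
    rw [integral_finsetSum _ fun i _ => integrable_finsetSum _ fun j _ => (hint i j).1]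
    refine Finset.sum_le_sum fun i hi => ?_
    rw [integral_finsetSum _ fun j _ => (hint i j).1,
      Finset.sum_eq_single_of_mem i hi fun j _ hj => (hint i j).2 hj.symm]
    have := integral_mono (hint i i).1 (integrable_const (‖x i‖ ^ 2)) fun ω => by
      show score τ (ε i ω) * score τ (ε i ω) * ⟪x i, x i⟫ ≤ ‖x i‖ ^ 2
      rw [real_inner_self_eq_norm_sq]
      refine mul_le_of_le_one_left (sq_nonneg _) ?_
      have := abs_le.1 (abs_score_le_one hτ (ε i ω))
      nlinarith
    simpa using this
  rw [le_div_iff₀ (by positivity), mul_comm]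
  have h := mul_meas_ge_le_integral_of_nonneg (ae_of_all _ fun ω => sq_nonneg _) hI (B ^ 2)
  have hset : {ω | B ^ 2 ≤ ‖scoreSum τ x (fun i => ε i ω) n‖ ^ 2}
      = {ω | B ≤ ‖scoreSum τ x (fun i => ε i ω) n‖} := by
    ext ω
    exact pow_le_pow_iff_left₀ hB.le (norm_nonneg _) two_ne_zero
  rw [hset] at h
  exact h.trans hE

/-- Markov's inequality: each indicator has mean at most C K ‖x_i‖. -/
lemma measureReal_remainderModulus_ge (hmeas : ∀ i, Measurable (ε i))
    (hlaw : ∀ i, P.map (ε i) = ν) (hmass : LinearMassAtZero ν c C δ)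
    (x : ℕ → E) (n : ℕ) {K Λ : ℝ} (hK : 0 ≤ K) (hx : ∀ i < n, K * ‖x i‖ ≤ δ) (hΛ : 0 < Λ) :
    P.real {ω | Λ ≤ remainderModulus x (fun i => ε i ω) n K}
      ≤ C * K * (∑ i ∈ Finset.range n, ‖x i‖ ^ 2) / Λ := by
  have hI : ∀ i, Integrable (fun ω => ‖x i‖ *
      Set.indicator (Set.Icc (-(K * ‖x i‖)) (K * ‖x i‖)) 1 (ε i ω)) P := fun i =>
    Integrable.const_mul (((integrable_const (1 : ℝ)).indicator
      (measurableSet_Icc.preimage (hmeas i)))) _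
  have h := mul_meas_ge_le_integral_of_nonneg
    (f := fun ω => remainderModulus x (fun i => ε i ω) n K) (μ := P)
    (ae_of_all _ fun ω => Finset.sum_nonneg fun i _ => mul_nonneg (norm_nonneg _)
      (Set.indicator_nonneg (fun _ _ => zero_le_one) _))
    (integrable_finsetSum _ fun i _ => hI i) Λ
  rw [le_div_iff₀ hΛ, mul_comm]
  refine h.trans ?_
  unfold remainderModulus
  rw [integral_finsetSum _ fun i _ => hI i, Finset.mul_sum]
  refine Finset.sum_le_sum fun i hi => ?_
  have h1 : ∫ ω, Set.indicator (Set.Icc (-(K * ‖x i‖)) (K * ‖x i‖)) (1 : ℝ → ℝ) (ε i ω) ∂P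
      = ν.real (Set.Icc (-(K * ‖x i‖)) (K * ‖x i‖)) := by
    rw [← integral_indicator_one measurableSet_Icc, ← hlaw i, integral_map (hmeas i).aemeasurable
      (measurable_one.indicator measurableSet_Icc).aestronglyMeasurable]
  rw [integral_const_mul, h1]
  refine (mul_le_mul_of_nonneg_left (hmass.upper _ (by positivity)
    (hx i (Finset.mem_range.1 hi))) (norm_nonneg _)).trans (le_of_eq ?_)
  ring

/-- Chebyshev's inequality. The bound h on the increments enters the variance linearly, so it can
beat any fixed deviation a. -/
lemma measureReal_remainderSum_le [IsFiniteMeasure ν] (hmeas : ∀ i, Measurable (ε i))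
    (hindep : iIndepFun ε P)
    (hlaw : ∀ i, P.map (ε i) = ν) (hmass : LinearMassAtZero ν c C δ) (hC : 0 ≤ C)
    (x : ℕ → E) (n : ℕ) (u : E) {h a : ℝ} (hx : ∀ i < n, |⟪x i, u⟫| ≤ h) (hhδ : h ≤ δ)
    (ha : 0 < a) :
    P.real {ω | remainderSum x (fun i => ε i ω) n u
        ≤ c / 4 * (∑ i ∈ Finset.range n, ⟪x i, u⟫ ^ 2) - a}
      ≤ C * h * (∑ i ∈ Finset.range n, ⟪x i, u⟫ ^ 2) / a ^ 2 := by
  set R : ℕ → Ω → ℝ := fun i ω => knightRemainder (ε i ω) ⟪x i, u⟫ with hR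
  have hRm : ∀ i, Measurable (R i) := fun i => (measurable_knightRemainder _).comp (hmeas i)
  have hL : ∀ i, MemLp (R i) 2 P := fun i => by
    have := memLp_knightRemainder (P.map (ε i)) ⟪x i, u⟫ 2
    exact this.comp_of_map (hmeas i).aemeasurable
  have hS : (fun ω => remainderSum x (fun i => ε i ω) n u) = ∑ i ∈ Finset.range n, R i := by
    ext ω
    simp [remainderSum, hR]
  have hmean : c / 4 * (∑ i ∈ Finset.range n, ⟪x i, u⟫ ^ 2)
      ≤ ∫ ω, (∑ i ∈ Finset.range n, R i) ω ∂P := by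
    simp only [Finset.sum_apply]
    rw [integral_finsetSum _ fun i _ => (hL i).integrable one_le_two, Finset.mul_sum]
    refine Finset.sum_le_sum fun i hi => ?_
    refine (le_integral_knightRemainder hmass
      ((hx i (Finset.mem_range.1 hi)).trans hhδ)).trans (le_of_eq ?_)
    rw [← hlaw i, integral_map (hmeas i).aemeasurable
      (measurable_knightRemainder _).aestronglyMeasurable]
  have hvar : variance (∑ i ∈ Finset.range n, R i) P
      ≤ C * h * ∑ i ∈ Finset.range n, ⟪x i, u⟫ ^ 2 := by
    rw [IndepFun.variance_sum (fun i _ => hL i) fun i _ j _ hij =>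
      (hindep.indepFun hij).comp (measurable_knightRemainder _) (measurable_knightRemainder _),
      Finset.mul_sum]
    refine Finset.sum_le_sum fun i hi => ?_
    refine (variance_le_expectation_sq (hRm i).aestronglyMeasurable).trans ?_
    have h1 : ∫ ω, (R i ^ 2) ω ∂P = ∫ e, knightRemainder e ⟪x i, u⟫ ^ 2 ∂ν := by
      rw [← hlaw i, integral_map (hmeas i).aemeasurable
        ((measurable_knightRemainder _).pow_const 2).aestronglyMeasurable]
      rfl
    rw [h1]
    have hxi := hx i (Finset.mem_range.1 hi)
    exact (integral_knightRemainder_sq_le hmass (hxi.trans hhδ)).trans (by gcongr)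
  have hcheb := meas_ge_le_variance_div_sq
    (memLp_finsetSum' (Finset.range n) fun i _ => hL i) ha
  rw [measureReal_def]
  have hqh : 0 ≤ C * h * ∑ i ∈ Finset.range n, ⟪x i, u⟫ ^ 2 := (variance_nonneg _ _).trans hvar
  refine ENNReal.toReal_le_of_le_ofReal (by positivity) ((measure_mono fun ω hω => ?_).trans
    (hcheb.trans (ENNReal.ofReal_le_ofReal (by gcongr))))
  have hω' : (∑ i ∈ Finset.range n, R i) ω
      ≤ c / 4 * (∑ i ∈ Finset.range n, ⟪x i, u⟫ ^ 2) - a := by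
    rw [← hS]; exact hω
  show a ≤ |_|
  rw [abs_sub_comm]
  exact le_trans (by linarith) (le_abs_self _)

/-- With probability at least `1 - κ`, for all large `n`, the local process of a normalized
triangular design exceeds `K` on the sphere of radius `K`, and is Lipschitz on the ball
of radius `K`. -/
theorem exists_local_event [IsFiniteMeasure ν] [FiniteDimensional ℝ E] (hτ : τ ∈ Set.Ioo (0 : ℝ) 1)
    (hmeas : ∀ i, Measurable (ε i)) (hindep : iIndepFun ε P) (hlaw : ∀ i, P.map (ε i) = ν)
    (hscore : ∫ e, score τ e ∂ν = 0) (hmass : LinearMassAtZero ν c C δ)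
    (hc : 0 < c) (hC : 0 < C) (hδ : 0 < δ) (x : ℕ → ℕ → E) {m T : ℝ} (hm : 0 < m) (hT : 0 < T)
    (hlow : ∀ᶠ n in atTop, ∀ u : E, m * ‖u‖ ^ 2 ≤ ∑ i ∈ Finset.range n, ⟪x n i, u⟫ ^ 2)
    (hup : ∀ᶠ n in atTop, ∑ i ∈ Finset.range n, ‖x n i‖ ^ 2 ≤ T)
    (hmax : ∀ η > 0, ∀ᶠ n in atTop, ∀ i < n, ‖x n i‖ ≤ η) {κ : ℝ} (hκ : 0 < κ) :
    ∃ K > 0, ∃ L : ℝ, ∀ᶠ n in atTop, ∃ A : Set Ω, P.real Aᶜ ≤ κ ∧ ∀ ω ∈ A,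
      (∀ u, ‖u‖ = K → K < localProcess τ (x n) (fun i => ε i ω) n u) ∧
      ∀ u v, ‖u‖ ≤ K → ‖v‖ ≤ K → localProcess τ (x n) (fun i => ε i ω) n u
        - localProcess τ (x n) (fun i => ε i ω) n v ≤ L * ‖u - v‖ := by
  -- Each of three bad events gets probability κ/3. K makes the quadratic term c m K²/4, reduced by
  -- two losses of a (a quarter of it each), equal to K (B + 2); the score costs at most B K, so
  -- more than K remains.
  set B : ℝ := √(3 * T / κ) with hBdef
  have hB : 0 < B := Real.sqrt_pos.2 (by positivity)
  have hB2 : B ^ 2 = 3 * T / κ := Real.sq_sqrt (by positivity)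
  set K : ℝ := 8 * (B + 2) / (c * m) with hKdef
  have hK : 0 < K := by positivity
  have hKeq : c * m * K = 8 * (B + 2) := by rw [hKdef]; field_simp
  set Λ : ℝ := 3 * C * K * T / κ with hΛdef
  have hΛ : 0 < Λ := by positivity
  set a : ℝ := c / 16 * m * K ^ 2 with hadef
  have ha : 0 < a := by positivity
  -- A net of mesh a/Λ: moving to a net point costs at most a in the remainder sum. It does not
  -- depend on n, so a union bound over it is harmless.
  obtain ⟨t, htK, htfin, hcover⟩ := (isCompact_sphere (0 : E) K).finite_cover_balls
    (e := a / Λ) (by positivity)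
  lift t to Finset E using htfin
  -- Small enough for the Chebyshev bounds over the net to add up to at most κ/3; the + 1 keeps the
  -- denominator positive for an empty net.
  set h : ℝ := min δ (κ * a ^ 2 / (3 * C * T * K ^ 2 * (t.card + 1))) with hhdef
  have hh : 0 < h := by positivity
  have hh2 : (t.card : ℝ) * (C * h * (T * K ^ 2) / a ^ 2) ≤ κ / 3 := by
    have h1 : h ≤ κ * a ^ 2 / (3 * C * T * K ^ 2 * (t.card + 1)) := min_le_right _ _
    rw [le_div_iff₀ (by positivity)] at h1
    rw [← mul_div_assoc, div_le_iff₀ (by positivity)]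
    nlinarith [show 0 ≤ 3 * C * T * K ^ 2 * h by positivity]
  refine ⟨K, hK, B + Λ, ?_⟩
  filter_upwards [hlow, hup, hmax (h / K) (by positivity)] with n hl hu hx
  have hx' : ∀ i < n, K * ‖x n i‖ ≤ h := fun i hi => by
    have := hx i hi
    rwa [le_div_iff₀ hK, mul_comm] at this
  set q : E → ℝ := fun u => ∑ i ∈ Finset.range n, ⟪x n i, u⟫ ^ 2 with hq
  set b1 : Set Ω := {ω | B ≤ ‖scoreSum τ (x n) (fun i => ε i ω) n‖} with hb1
  set b2 : Set Ω := {ω | Λ ≤ remainderModulus (x n) (fun i => ε i ω) n K} with hb2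
  set b3 : E → Set Ω := fun u =>
    {ω | remainderSum (x n) (fun i => ε i ω) n u ≤ c / 4 * q u - a} with hb3
  have p1 : P.real b1 ≤ κ / 3 := by
    refine (measureReal_norm_scoreSum_ge hτ hmeas hindep hlaw hscore (x n) n hB).trans ?_
    rw [hB2, div_le_iff₀ (by positivity)]
    calc _ ≤ T := hu
      _ = κ / 3 * (3 * T / κ) := by field_simp
  have p2 : P.real b2 ≤ κ / 3 := by
    refine (measureReal_remainderModulus_ge hmeas hlaw hmass (x n) n hK.le
      (fun i hi => (hx' i hi).trans (min_le_left _ _)) hΛ).trans ?_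
    rw [div_le_iff₀ hΛ]
    calc _ ≤ C * K * T := by gcongr
      _ = κ / 3 * Λ := by rw [hΛdef]; field_simp
  have p3 : ∀ u ∈ t, P.real (b3 u) ≤ C * h * (T * K ^ 2) / a ^ 2 := by
    intro u hut
    have huK : ‖u‖ = K := by simpa using htK hut
    refine (measureReal_remainderSum_le hmeas hindep hlaw hmass hC.le (x n) n u (h := h)
      (fun i hi => ?_) (min_le_left _ _) ha).trans ?_
    · refine (abs_real_inner_le_norm _ _).trans ?_
      rw [huK, mul_comm]
      exact hx' i hi
    · gcongr
      refine le_trans (Finset.sum_le_sum fun i _ => ?_)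
        ((Finset.sum_mul _ _ _).symm.le.trans (mul_le_mul_of_nonneg_right hu (sq_nonneg K)))
      rw [← mul_pow, ← huK, ← sq_abs]
      exact pow_le_pow_left₀ (abs_nonneg _) (abs_real_inner_le_norm _ _) 2
  refine ⟨(b1 ∪ b2 ∪ ⋃ u ∈ t, b3 u)ᶜ, ?_, ?_⟩
  · rw [compl_compl]
    have h3 : P.real (⋃ u ∈ t, b3 u) ≤ κ / 3 := by
      refine (measureReal_biUnion_finset_le t b3).trans ((Finset.sum_le_sum p3).trans ?_)
      rwa [Finset.sum_const, nsmul_eq_mul]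
    linarith [measureReal_union_le (μ := P) (b1 ∪ b2) (⋃ u ∈ t, b3 u),
      measureReal_union_le (μ := P) b1 b2]
  · intro ω hω
    simp only [Set.mem_compl_iff, Set.mem_union, Set.mem_iUnion, not_or, not_exists] at hω
    obtain ⟨⟨h1, h2⟩, h3⟩ := hω
    have h1' : ‖scoreSum τ (x n) (fun i => ε i ω) n‖ < B := not_le.1 h1
    have h2' : remainderModulus (x n) (fun i => ε i ω) n K < Λ := not_le.1 h2
    constructor
    · intro u hu
      obtain ⟨v, hvt, hv⟩ : ∃ v ∈ t, u ∈ Metric.ball v (a / Λ) := by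
        have := hcover (show u ∈ Metric.sphere (0 : E) K by simpa using hu)
        simpa using this
      have hvK : ‖v‖ = K := by simpa using htK hvt
      have h3' : c / 4 * q v - a < remainderSum (x n) (fun i => ε i ω) n v :=
        not_le.1 (h3 v hvt)
      have hqv : m * K ^ 2 ≤ q v := by rw [← hvK]; exact hl v
      have hlip := (abs_le.1 (abs_remainderSum_sub_le (x n) (fun i => ε i ω) n hu.le hvK.le)).1
      have huv : ‖u - v‖ ≤ a / Λ := by
        rw [← dist_eq_norm]; exact (Metric.mem_ball.1 hv).le
      have hlip2 : remainderModulus (x n) (fun i => ε i ω) n K * ‖u - v‖ ≤ a := by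
        calc _ ≤ Λ * (a / Λ) := by gcongr
          _ = a := by field_simp
      have hW : ⟪scoreSum τ (x n) (fun i => ε i ω) n, u⟫ ≤ B * K := by
        refine (real_inner_le_norm _ _).trans ?_
        rw [hu]; gcongr
      rw [localProcess_eq]
      have hfin : c / 4 * (m * K ^ 2) - 2 * a = K * (B + 2) := by
        rw [hadef]
        linear_combination K / 8 * hKeq
      have := mul_le_mul_of_nonneg_left hqv (by positivity : 0 ≤ c / 4)
      nlinarith
    · intro u v hu hv
      rw [localProcess_eq, localProcess_eq]
      have hlip := (abs_le.1 (abs_remainderSum_sub_le (x n) (fun i => ε i ω) n hu hv)).2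
      have hW : -⟪scoreSum τ (x n) (fun i => ε i ω) n, u - v⟫ ≤ B * ‖u - v‖ :=
        (neg_le_abs _).trans ((abs_real_inner_le_norm _ _).trans (by gcongr))
      rw [inner_sub_right] at hW
      have := mul_le_mul_of_nonneg_right h2'.le (norm_nonneg (u - v))
      linarith

end Probability

/-! ### Localization of minimizers by convexity -/

/-- A point outside the ball, scaled back to the sphere, would have value at most K. Allowing ‖u‖ in
place of 0 leaves room for the penalty. -/
lemma norm_lt_of_convexOn {E : Type*} [NormedAddCommGroup E] [NormedSpace ℝ E] {Z : E → ℝ}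
    (hZ : ConvexOn ℝ Set.univ Z) (h0 : Z 0 = 0) {K : ℝ} (hK : 0 < K)
    (hsphere : ∀ u, ‖u‖ = K → K < Z u) {u : E} (hu : Z u ≤ ‖u‖) : ‖u‖ < K := by
  by_contra! h
  have hpos : 0 < ‖u‖ := hK.trans_le h
  set s := K / ‖u‖
  have hs0 : 0 ≤ s := by positivity
  have hs1 : s ≤ 1 := (div_le_one hpos).2 h
  have hsu : s * ‖u‖ = K := div_mul_cancel₀ _ hpos.ne'
  have h1 := hZ.2 (Set.mem_univ u) (Set.mem_univ 0) hs0 (sub_nonneg.2 hs1) (by ring)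
  rw [smul_zero, add_zero, h0, smul_zero, add_zero, smul_eq_mul] at h1
  have h2 := hsphere (s • u) (by rw [norm_smul, Real.norm_of_nonneg hs0, hsu])
  nlinarith [mul_le_mul_of_nonneg_left hu hs0]

lemma convexOn_localProcess {E : Type*} [NormedAddCommGroup E] [InnerProductSpace ℝ E]
    (τ : ℝ) (x : ℕ → E) (e : ℕ → ℝ) (n : ℕ) :
    ConvexOn ℝ Set.univ (localProcess τ x e n) := by
  have h : ∀ s : Finset ℕ, ConvexOn ℝ Set.univ fun u : E =>
      ∑ i ∈ s, (checkFunction τ (e i - ⟪x i, u⟫) - checkFunction τ (e i)) := by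
    intro s
    induction s using Finset.induction_on with
    | empty => simpa using convexOn_const (0 : ℝ) convex_univ
    | insert i s hi ih =>
      simp only [Finset.sum_insert hi]
      refine ConvexOn.add ?_ ih
      simp only [sub_eq_add_neg (checkFunction τ _)]
      refine ConvexOn.add ?_ (convexOn_const _ convex_univ)
      refine ⟨convex_univ, fun u _ v _ a b ha hb hab => ?_⟩
      have := (convexOn_checkFunction τ).2 (Set.mem_univ (e i - ⟪x i, u⟫))
        (Set.mem_univ (e i - ⟪x i, v⟫)) ha hb hab
      refine le_of_eq_of_le (congrArg _ ?_) this
      rw [inner_add_right, real_inner_smul_right, real_inner_smul_right, smul_eq_mul, smul_eq_mul]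
      linear_combination (-e i) * hab
  exact h _

lemma localProcess_zero {E : Type*} [NormedAddCommGroup E] [InnerProductSpace ℝ E]
    (τ : ℝ) (x : ℕ → E) (e : ℕ → ℝ) (n : ℕ) : localProcess τ x e n 0 = 0 := by
  simp [localProcess]

/-! ### Comparison of penalties with possibly infinite weights -/

/-- A bounded weight makes the term Lipschitz; where the norm does not increase, no control of the
weight is needed, even if it is ∞. -/
lemma weight_mul_le {V : Type*} [NormedAddCommGroup V] {w : ℝ≥0∞} {D h : ℝ} {a b : V}
    (hD : 0 ≤ D) (hw : w ≤ ENNReal.ofReal D ∨ ‖a‖ ≤ ‖b‖) (hab : ‖b - a‖ ≤ h) :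
    w * ‖a‖ₑ ≤ w * ‖b‖ₑ + ENNReal.ofReal (D * h) := by
  rcases hw with hw | hw
  · have h1 : ‖a‖ₑ ≤ ‖b‖ₑ + ENNReal.ofReal h := by
      rw [← ofReal_norm, ← ofReal_norm,
        ← ENNReal.ofReal_add (norm_nonneg _) ((norm_nonneg _).trans hab)]
      refine ENNReal.ofReal_le_ofReal ?_
      linarith [norm_sub_norm_le a b, norm_sub_rev a b]
    calc w * ‖a‖ₑ ≤ w * (‖b‖ₑ + ENNReal.ofReal h) := by gcongr
      _ = w * ‖b‖ₑ + w * ENNReal.ofReal h := mul_add _ _ _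
      _ ≤ w * ‖b‖ₑ + ENNReal.ofReal D * ENNReal.ofReal h := by gcongr
      _ = _ := by rw [ENNReal.ofReal_mul hD]
  · refine le_add_right ?_
    have : ‖a‖ₑ ≤ ‖b‖ₑ := enorm_le_iff_norm_le.2 hw
    gcongr

lemma mul_sum_le_mul_sum_add {ι : Type*} (s : Finset ι) {N : ℕ} (hN : s.card ≤ N) (μ : ℝ≥0)
    {f g : ι → ℝ≥0∞} {h : ℝ} (hfg : ∀ i ∈ s, f i ≤ g i + ENNReal.ofReal h) :
    μ * ∑ i ∈ s, f i ≤ μ * ∑ i ∈ s, g i + ENNReal.ofReal (μ * (N * h)) := by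
  rw [ENNReal.ofReal_mul μ.coe_nonneg, ENNReal.ofReal_coe_nnreal, ← mul_add]
  gcongr
  refine (Finset.sum_le_sum hfg).trans ?_
  rw [Finset.sum_add_distrib, Finset.sum_const, nsmul_eq_mul,
    ENNReal.ofReal_mul (Nat.cast_nonneg N), ENNReal.ofReal_natCast]
  gcongr

lemma add_le_add_of_ofReal_add_le {g g' a c : ℝ} {r r' : ℝ≥0∞} (hg : 0 ≤ g) (hg' : 0 ≤ g')
    (ha : 0 ≤ a) (hc : 0 ≤ c) (hr : r ≠ ∞) (h : ENNReal.ofReal g + r ≤ ENNReal.ofReal g' + r')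
    (hrr : r' + ENNReal.ofReal a ≤ r + ENNReal.ofReal c) : g + a ≤ g' + c := by
  have h1 : ENNReal.ofReal (g + a) + r ≤ ENNReal.ofReal (g' + c) + r := by
    rw [ENNReal.ofReal_add hg ha, ENNReal.ofReal_add hg' hc]
    calc _ = ENNReal.ofReal g + r + ENNReal.ofReal a := by ring
      _ ≤ ENNReal.ofReal g' + r' + ENNReal.ofReal a := by gcongr
      _ = ENNReal.ofReal g' + (r' + ENNReal.ofReal a) := add_assoc _ _ _
      _ ≤ ENNReal.ofReal g' + (r + ENNReal.ofReal c) := by gcongr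
      _ = _ := by ring
  rw [ENNReal.add_le_add_iff_right hr] at h1
  exact (ENNReal.ofReal_le_ofReal_iff (by positivity)).1 h1

section Penalty

variable {p d : ℕ} {γ : ℝ}

lemma adaptiveWeight_le (hγ : 0 < γ) {v : EuclideanSpace ℝ (Fin d)} {r : ℝ} (hr : 0 < r)
    (hv : r ≤ ‖v‖) : adaptiveWeight γ v ≤ ENNReal.ofReal (r ^ (-γ)) := by
  unfold adaptiveWeight
  rw [← ENNReal.ofReal_rpow_of_pos hr, ENNReal.rpow_neg, ENNReal.rpow_neg, ← ofReal_norm]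
  gcongr

lemma le_adaptiveWeight (hγ : 0 < γ) {v : EuclideanSpace ℝ (Fin d)} {r : ℝ} (hr : 0 < r)
    (hv : ‖v‖ ≤ r) : ENNReal.ofReal (r ^ (-γ)) ≤ adaptiveWeight γ v := by
  unfold adaptiveWeight
  rw [← ENNReal.ofReal_rpow_of_pos hr, ENNReal.rpow_neg, ENNReal.rpow_neg, ← ofReal_norm]
  gcongr

/-- The adaptive fused group LASSO penalty. -/
noncomputable def fusedPenalty (γ : ℝ) (μ₁ μ₂ : ℝ≥0) (b β : GroupedVec p d) : ℝ≥0∞ :=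
  μ₁ * ∑ j : Fin p, adaptiveWeight γ (b j) * ‖β j‖ₑ
    + μ₂ * ∑ q : Fin p × Fin p with q.1.val + 1 = q.2.val,
        adaptiveWeight γ (b q.2 - b q.1) * ‖β q.2 - β q.1‖ₑ

lemma penalizedProcess_eq (τ γ : ℝ) (X : ℕ → GroupedVec p d) (y : ℕ → ℝ) (n : ℕ)
    (μ₁ μ₂ : ℝ≥0) (b β : GroupedVec p d) :
    penalizedProcess τ γ X y n μ₁ μ₂ b β
      = ENNReal.ofReal (quantileProcess τ X y n β) + fusedPenalty γ μ₁ μ₂ b β :=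
  add_assoc _ _ _

lemma norm_apply_sub_le (u v : GroupedVec p d) (j : Fin p) : ‖u j - v j‖ ≤ ‖u - v‖ :=
  PiLp.norm_apply_le (u - v) j

lemma norm_le_of_forall_norm_apply_le {u v : GroupedVec p d} (h : ∀ j, ‖u j‖ ≤ ‖v j‖) :
    ‖u‖ ≤ ‖v‖ := by
  rw [PiLp.norm_eq_of_L2, PiLp.norm_eq_of_L2]
  exact Real.sqrt_le_sqrt (Finset.sum_le_sum fun j _ => pow_le_pow_left₀ (norm_nonneg _) (h j) 2)

lemma norm_le_sum_norm_apply (u : GroupedVec p d) : ‖u‖ ≤ ∑ j, ‖u j‖ := by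
  rw [PiLp.norm_eq_of_L2]
  refine Real.sqrt_le_iff.2 ⟨Finset.sum_nonneg fun j _ => norm_nonneg _, ?_⟩
  exact Finset.sum_sq_le_sq_sum_of_nonneg fun j _ => norm_nonneg _

lemma fusion_sum_le (μ : ℝ≥0) (b β β' : GroupedVec p d) {D : ℝ} (hD : 0 ≤ D)
    (h : ∀ q : Fin p × Fin p, adaptiveWeight γ (b q.2 - b q.1) ≤ ENNReal.ofReal D ∨
      ‖β' q.2 - β' q.1‖ ≤ ‖β q.2 - β q.1‖) :
    μ * ∑ q : Fin p × Fin p with q.1.val + 1 = q.2.val,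
        adaptiveWeight γ (b q.2 - b q.1) * ‖β' q.2 - β' q.1‖ₑ
      ≤ μ * ∑ q : Fin p × Fin p with q.1.val + 1 = q.2.val,
        adaptiveWeight γ (b q.2 - b q.1) * ‖β q.2 - β q.1‖ₑ
        + ENNReal.ofReal (μ * ((p * p : ℕ) * (D * (2 * ‖β - β'‖)))) := by
  refine mul_sum_le_mul_sum_add _ ((Finset.card_filter_le _ _).trans (by simp)) μ fun q _ => ?_
  refine weight_mul_le hD (h q) ?_
  have h1 := norm_apply_sub_le β β' q.1
  have h2 := norm_apply_sub_le β β' q.2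
  have h3 := norm_sub_le (β q.2 - β' q.2) (β q.1 - β' q.1)
  rw [sub_sub_sub_comm]
  linarith

/-- The part of `β` that is supported on the active groups of `β₀`. -/
noncomputable def restrictActive (β₀ β : GroupedVec p d) : GroupedVec p d :=
  open Classical in WithLp.toLp 2 fun j => if β₀ j = 0 then 0 else β j

lemma restrictActive_of_eq_zero {β₀ : GroupedVec p d} (β : GroupedVec p d) {j : Fin p}
    (h : β₀ j = 0) : restrictActive β₀ β j = 0 := by
  simp [restrictActive, h]

lemma restrictActive_of_ne_zero {β₀ : GroupedVec p d} (β : GroupedVec p d) {j : Fin p}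
    (h : β₀ j ≠ 0) : restrictActive β₀ β j = β j := by
  simp [restrictActive, h]

lemma norm_restrictActive_sub_le (β₀ β : GroupedVec p d) :
    ‖restrictActive β₀ β - β₀‖ ≤ ‖β - β₀‖ := by
  refine norm_le_of_forall_norm_apply_le fun j => ?_
  rw [PiLp.sub_apply, PiLp.sub_apply]
  by_cases h : β₀ j = 0
  · rw [restrictActive_of_eq_zero β h, h]; simp
  · rw [restrictActive_of_ne_zero β h]

/-- The pilot vector `b` makes the weights of the truly non-vanishing groups and group
differences at most `D`. -/
def BoundedWeights (γ : ℝ) (b β₀ : GroupedVec p d) (D : ℝ) : Prop :=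
  (∀ j, β₀ j ≠ 0 → adaptiveWeight γ (b j) ≤ ENNReal.ofReal D) ∧
    ∀ q : Fin p × Fin p, β₀ q.2 ≠ β₀ q.1 → adaptiveWeight γ (b q.2 - b q.1) ≤ ENNReal.ofReal D

/-- Terms that vanish at β₀ can only decrease, whatever their weight; all the others have weight at
most D. -/
lemma fusedPenalty_true_le {b β₀ : GroupedVec p d} {D : ℝ} (hD : 0 ≤ D)
    (hb : BoundedWeights γ b β₀ D) (μ₁ μ₂ : ℝ≥0) (β : GroupedVec p d) :
    fusedPenalty γ μ₁ μ₂ b β₀ ≤ fusedPenalty γ μ₁ μ₂ b β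
      + ENNReal.ofReal ((p * D * μ₁ + 2 * p ^ 2 * D * μ₂) * ‖β - β₀‖) := by
  have h1 := mul_sum_le_mul_sum_add (Finset.univ : Finset (Fin p)) (N := p) (by simp) μ₁
    (f := fun j => adaptiveWeight γ (b j) * ‖β₀ j‖ₑ) (g := fun j => adaptiveWeight γ (b j) * ‖β j‖ₑ)
    (h := D * ‖β - β₀‖) fun j _ => by
      refine weight_mul_le hD ?_ (norm_apply_sub_le β β₀ j)
      by_cases h : β₀ j = 0
      · right; rw [h]; simp
      · exact Or.inl (hb.1 j h)
  have h2 := fusion_sum_le (γ := γ) μ₂ b β β₀ hD fun q => by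
    by_cases h : β₀ q.2 = β₀ q.1
    · right; rw [h]; simp
    · exact Or.inl (hb.2 q h)
  unfold fusedPenalty
  refine (add_le_add h1 h2).trans (le_of_eq ?_)
  rw [add_add_add_comm, ← ENNReal.ofReal_add (by positivity) (by positivity)]
  congr 2
  push_cast
  ring

/-- Each deleted group saves at least μ₁ W times its norm. In the fusion sum, a pair with equal true
groups is either annihilated or unchanged, so an increase occurs only where the weight is at most D.
-/
lemma fusedPenalty_restrictActive_le {b β₀ : GroupedVec p d} {D W : ℝ} (hD : 0 ≤ D) (hW : 0 ≤ W)
    (hb : BoundedWeights γ b β₀ D)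
    (hw : ∀ j, β₀ j = 0 → ENNReal.ofReal W ≤ adaptiveWeight γ (b j))
    (μ₁ μ₂ : ℝ≥0) (β : GroupedVec p d) :
    fusedPenalty γ μ₁ μ₂ b (restrictActive β₀ β)
        + ENNReal.ofReal (μ₁ * W * ‖β - restrictActive β₀ β‖)
      ≤ fusedPenalty γ μ₁ μ₂ b β
        + ENNReal.ofReal (2 * p ^ 2 * D * μ₂ * ‖β - restrictActive β₀ β‖) := by
  set β' := restrictActive β₀ β with hβ'
  have h1 : μ₁ * ∑ j : Fin p, adaptiveWeight γ (b j) * ‖β' j‖ₑ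
      + ENNReal.ofReal (μ₁ * W * ‖β - β'‖)
      ≤ μ₁ * ∑ j : Fin p, adaptiveWeight γ (b j) * ‖β j‖ₑ := by
    have h3 : ENNReal.ofReal (W * ‖β - β'‖) ≤ ∑ j : Fin p, ENNReal.ofReal W * ‖β j - β' j‖ₑ := by
      rw [← Finset.mul_sum, ENNReal.ofReal_mul hW]
      gcongr
      refine (ENNReal.ofReal_le_ofReal (norm_le_sum_norm_apply _)).trans (le_of_eq ?_)
      rw [ENNReal.ofReal_sum_of_nonneg fun _ _ => norm_nonneg _]
      simp only [ofReal_norm, PiLp.sub_apply]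
    rw [mul_assoc, ENNReal.ofReal_mul μ₁.coe_nonneg, ENNReal.ofReal_coe_nnreal, ← mul_add]
    gcongr
    refine (add_le_add_right h3 _).trans ?_
    rw [← Finset.sum_add_distrib]
    refine Finset.sum_le_sum fun j _ => ?_
    by_cases h : β₀ j = 0
    · rw [hβ', restrictActive_of_eq_zero β h, sub_zero, enorm_zero, mul_zero, zero_add]
      gcongr
      exact hw j h
    · rw [hβ', restrictActive_of_ne_zero β h, sub_self, enorm_zero, mul_zero, add_zero]
  have h2 := fusion_sum_le (γ := γ) μ₂ b β β' hD fun q => by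
    by_cases h : β₀ q.2 = β₀ q.1
    · right
      by_cases h0 : β₀ q.1 = 0
      · rw [hβ', restrictActive_of_eq_zero β h0, restrictActive_of_eq_zero β (h.trans h0)]; simp
      · rw [hβ', restrictActive_of_ne_zero β h0, restrictActive_of_ne_zero β (h ▸ h0)]
    · exact Or.inl (hb.2 q h)
  unfold fusedPenalty
  rw [add_right_comm]
  refine (add_le_add h1 h2).trans (le_of_eq ?_)
  rw [add_assoc]
  congr 3
  push_cast
  ring

lemma fusedPenalty_zero (μ₁ μ₂ : ℝ≥0) (b : GroupedVec p d) : fusedPenalty γ μ₁ μ₂ b 0 = 0 := by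
  simp [fusedPenalty]

lemma quantileProcess_nonneg {τ : ℝ} (hτ : τ ∈ Set.Ioo (0 : ℝ) 1) (X : ℕ → GroupedVec p d)
    (y : ℕ → ℝ) (n : ℕ) (β : GroupedVec p d) : 0 ≤ quantileProcess τ X y n β :=
  Finset.sum_nonneg fun _ _ => checkFunction_nonneg hτ _

lemma quantileProcess_sub {τ : ℝ} {X : ℕ → GroupedVec p d} {y e : ℕ → ℝ} {β₀ : GroupedVec p d}
    (hy : ∀ i, y i = ⟪X i, β₀⟫ + e i) {n : ℕ} (hn : 0 < n) (β : GroupedVec p d) :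
    quantileProcess τ X y n β - quantileProcess τ X y n β₀
      = localProcess τ (fun i => (√n)⁻¹ • X i) e n (√n • (β - β₀)) := by
  have hs : √(n : ℝ) ≠ 0 := (Real.sqrt_pos.2 (by exact_mod_cast hn)).ne'
  unfold quantileProcess localProcess
  rw [← Finset.sum_sub_distrib]
  refine Finset.sum_congr rfl fun i _ => ?_
  rw [real_inner_smul_left, real_inner_smul_right, inv_mul_cancel_left₀ hs, inner_sub_right, hy i]
  congr 2 <;> ring

/-- The deterministic core: ρ separates the nonzero true groups and differences from 0. `hsmall`
gives the rate K/√n for the penalized minimizer, and `hlarge` gives sparsity. -/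
lemma activeGroups_eq_of_local {τ : ℝ} (hτ : τ ∈ Set.Ioo (0 : ℝ) 1) (hγ : 0 < γ)
    {X : ℕ → GroupedVec p d} {y e : ℕ → ℝ} {β₀ : GroupedVec p d}
    (hy : ∀ i, y i = ⟪X i, β₀⟫ + e i) {n : ℕ} (hn : 0 < n) {K L D ρ : ℝ} (hK : 0 < K)
    (hsphere : ∀ u, ‖u‖ = K → K < localProcess τ (fun i => (√n)⁻¹ • X i) e n u)
    (hlip : ∀ u v, ‖u‖ ≤ K → ‖v‖ ≤ K → localProcess τ (fun i => (√n)⁻¹ • X i) e n u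
        - localProcess τ (fun i => (√n)⁻¹ • X i) e n v ≤ L * ‖u - v‖)
    (hρ : 0 < ρ) (hD : D = (ρ / 2) ^ (-γ)) (hactive : ∀ j, β₀ j ≠ 0 → ρ ≤ ‖β₀ j‖)
    (hdiff : ∀ i j, β₀ i ≠ β₀ j → ρ ≤ ‖β₀ i - β₀ j‖) (hKn : 2 * (K / √n) ≤ ρ / 2)
    {μ₁ μ₂ : ℝ≥0} (hsmall : p * D * μ₁ + 2 * p ^ 2 * D * μ₂ ≤ √n)
    (hlarge : √n * L + 2 * p ^ 2 * D * μ₂ < μ₁ * (K / √n) ^ (-γ))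
    {b β : GroupedVec p d} (hb : IsMinOn (quantileProcess τ X y n) Set.univ b)
    (hβ : IsMinOn (penalizedProcess τ γ X y n μ₁ μ₂ b) Set.univ β) :
    activeGroups β = activeGroups β₀ := by
  have hs : 0 < √(n : ℝ) := Real.sqrt_pos.2 (by exact_mod_cast hn)
  have hD0 : 0 ≤ D := by rw [hD]; positivity
  have hnorm : ∀ u : GroupedVec p d, ‖√(n : ℝ) • u‖ = √n * ‖u‖ := fun u => by
    rw [norm_smul, Real.norm_of_nonneg hs.le]
  have hrate : ∀ v : GroupedVec p d, quantileProcess τ X y n v - quantileProcess τ X y n β₀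
      ≤ √n * ‖v - β₀‖ → ‖v - β₀‖ < K / √n := by
    intro v hv
    rw [quantileProcess_sub hy hn, ← hnorm] at hv
    have := norm_lt_of_convexOn (convexOn_localProcess _ _ _ _) (localProcess_zero _ _ _ _)
      hK hsphere hv
    rwa [hnorm, mul_comm, ← lt_div_iff₀ hs] at this
  have hb' : ‖b - β₀‖ < K / √n := by
    refine hrate b ?_
    have : quantileProcess τ X y n b ≤ quantileProcess τ X y n β₀ := hb (Set.mem_univ β₀)
    have := mul_nonneg hs.le (norm_nonneg (b - β₀))
    linarith
  have hKpos : 0 < K / √n := by positivity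
  -- Groups move by less than K/√n and differences by less than 2K/√n ≤ ρ/2, so norms that were at
  -- least ρ stay at least ρ/2.
  have hweights : BoundedWeights γ b β₀ D := by
    rw [hD]
    refine ⟨fun j hj => adaptiveWeight_le hγ (by positivity) ?_,
      fun q hq => adaptiveWeight_le hγ (by positivity) ?_⟩
    · have h1 := norm_sub_norm_le (β₀ j) (b j)
      have h2 := norm_apply_sub_le β₀ b j
      rw [norm_sub_rev β₀ b] at h2
      linarith [hactive j hj]
    · have h1 := norm_sub_norm_le (β₀ q.2 - β₀ q.1) (b q.2 - b q.1)
      rw [sub_sub_sub_comm] at h1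
      have h2 := norm_apply_sub_le β₀ b q.1
      have h3 := norm_apply_sub_le β₀ b q.2
      have h4 := norm_sub_le (β₀ q.2 - b q.2) (β₀ q.1 - b q.1)
      rw [norm_sub_rev β₀ b] at h2 h3
      linarith [hdiff q.2 q.1 hq]
  have hmin : ∀ v, ENNReal.ofReal (quantileProcess τ X y n β) + fusedPenalty γ μ₁ μ₂ b β
      ≤ ENNReal.ofReal (quantileProcess τ X y n v) + fusedPenalty γ μ₁ μ₂ b v := fun v => by
    have : penalizedProcess τ γ X y n μ₁ μ₂ b β ≤ penalizedProcess τ γ X y n μ₁ μ₂ b v :=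
      hβ (Set.mem_univ v)
    rwa [penalizedProcess_eq, penalizedProcess_eq] at this
  -- The zero vector has no penalty, so the minimum is finite; this permits cancelling penalties in
  -- `ℝ≥0∞`.
  have hfin : fusedPenalty γ μ₁ μ₂ b β ≠ ∞ := by
    have := hmin 0
    rw [fusedPenalty_zero, add_zero] at this
    exact ((le_add_left le_rfl).trans_lt (this.trans_lt ENNReal.ofReal_lt_top)).ne
  have hβ' : ‖β - β₀‖ < K / √n := by
    refine hrate β ?_
    have := add_le_add_of_ofReal_add_le (quantileProcess_nonneg hτ X y n β)
      (quantileProcess_nonneg hτ X y n β₀) le_rfl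
      (c := (p * D * μ₁ + 2 * p ^ 2 * D * μ₂) * ‖β - β₀‖) (by positivity) hfin (hmin β₀)
      (by simpa using fusedPenalty_true_le hD0 hweights μ₁ μ₂ β)
    have := mul_le_mul_of_nonneg_right hsmall (norm_nonneg (β - β₀))
    linarith
  have hzero : ‖β - restrictActive β₀ β‖ = 0 := by
    have h1 := add_le_add_of_ofReal_add_le (quantileProcess_nonneg hτ X y n β)
      (quantileProcess_nonneg hτ X y n (restrictActive β₀ β)) (by positivity) (by positivity) hfin
      (hmin (restrictActive β₀ β))
      (fusedPenalty_restrictActive_le hD0 (W := (K / √n) ^ (-γ)) (by positivity) hweights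
        (fun j hj => le_adaptiveWeight hγ hKpos (by
          have := norm_apply_sub_le b β₀ j
          rw [hj, sub_zero] at this
          exact this.trans hb'.le)) μ₁ μ₂ β)
    have hball : ∀ v : GroupedVec p d, ‖v - β₀‖ ≤ K / √n → ‖√(n : ℝ) • (v - β₀)‖ ≤ K :=
      fun v hv => by rwa [hnorm, mul_comm, ← le_div_iff₀ hs]
    have h2 := hlip _ _ (hball _ ((norm_restrictActive_sub_le β₀ β).trans hβ'.le))
      (hball β hβ'.le)
    rw [← quantileProcess_sub hy hn, ← quantileProcess_sub hy hn, ← smul_sub,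
      sub_sub_sub_cancel_right, sub_sub_sub_cancel_right, hnorm, norm_sub_rev] at h2
    by_contra h0
    have hpos : 0 < ‖β - restrictActive β₀ β‖ := lt_of_le_of_ne (norm_nonneg _) (Ne.symm h0)
    have h3 := mul_lt_mul_of_pos_right hlarge hpos
    linarith
  have heq : β = restrictActive β₀ β := sub_eq_zero.1 (norm_eq_zero.1 hzero)
  ext j
  simp only [activeGroups, Set.mem_ofPred_eq, ne_eq, norm_eq_zero, not_iff_not]
  constructor
  · intro hj
    by_contra h0
    have h1 := norm_apply_sub_le β β₀ j
    rw [hj, zero_sub, norm_neg] at h1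
    linarith [hactive j h0]
  · intro hj
    rw [heq, restrictActive_of_eq_zero β hj]

end Penalty

/-! ### Spectral bounds on the design -/

section Gram

variable {p d : ℕ}

lemma inner_eq_dotProduct (u v : GroupedVec p d) :
    ⟪u, v⟫ = (fun a : Fin p × Fin d => u a.1 a.2) ⬝ᵥ fun a => v a.1 a.2 := by
  simp [PiLp.inner_apply, dotProduct, Fintype.sum_prod_type, mul_comm]

lemma gramMatrix_isHermitian (X : ℕ → GroupedVec p d) (n : ℕ) : (gramMatrix X n).IsHermitian := by
  ext a b
  simp [gramMatrix, Matrix.sum_apply, Matrix.vecMulVec_apply, mul_comm]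

lemma dotProduct_gramMatrix_mulVec (X : ℕ → GroupedVec p d) (n : ℕ) (v : GroupedVec p d) :
    (fun a : Fin p × Fin d => v a.1 a.2) ⬝ᵥ (gramMatrix X n).mulVec (fun a => v a.1 a.2)
      = (n : ℝ)⁻¹ * ∑ i ∈ Finset.range n, ⟪X i, v⟫ ^ 2 := by
  rw [gramMatrix, Matrix.smul_mulVec, dotProduct_smul, smul_eq_mul, Matrix.sum_mulVec,
    dotProduct_sum]
  congr 1
  refine Finset.sum_congr rfl fun i _ => ?_
  rw [Matrix.vecMulVec_mulVec, inner_eq_dotProduct, dotProduct_smul, sq]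
  simp [dotProduct_comm]

lemma le_sum_inner_sq_of_spectrum {X : ℕ → GroupedVec p d} {n : ℕ} {m₀ M₀ : ℝ}
    (h : spectrum ℝ (gramMatrix X n) ⊆ Set.Icc m₀ M₀) (v : GroupedVec p d) :
    m₀ * ‖v‖ ^ 2 ≤ (n : ℝ)⁻¹ * ∑ i ∈ Finset.range n, ⟪X i, v⟫ ^ 2 := by
  have hpsd : (gramMatrix X n - algebraMap ℝ _ m₀).PosSemidef := by
    rw [Matrix.posSemidef_iff_isHermitian_and_spectrum_nonneg]
    refine ⟨(gramMatrix_isHermitian X n).sub ?_, ?_⟩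
    · rw [Algebra.algebraMap_eq_smul_one]
      ext a b
      simp [Matrix.one_apply, eq_comm]
    · rw [← spectrum.sub_singleton_eq]
      rintro _ ⟨a, ha, b, rfl, rfl⟩
      exact sub_nonneg.2 (h ha).1
  have := hpsd.dotProduct_mulVec_nonneg (fun a : Fin p × Fin d => v a.1 a.2)
  rw [Matrix.sub_mulVec, dotProduct_sub, star_trivial, dotProduct_gramMatrix_mulVec,
    Algebra.algebraMap_eq_smul_one, Matrix.smul_mulVec, Matrix.one_mulVec, dotProduct_smul,
    ← inner_eq_dotProduct, real_inner_self_eq_norm_sq, smul_eq_mul] at this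
  linarith

/-- Both sides compare with the trace, a sum of p d eigenvalues. -/
lemma sum_norm_sq_le_of_spectrum {X : ℕ → GroupedVec p d} {n : ℕ} {m₀ M₀ : ℝ}
    (h : spectrum ℝ (gramMatrix X n) ⊆ Set.Icc m₀ M₀) :
    (n : ℝ)⁻¹ * ∑ i ∈ Finset.range n, ‖X i‖ ^ 2 ≤ (p * d : ℕ) * M₀ := by
  have htr : (gramMatrix X n).trace = (n : ℝ)⁻¹ * ∑ i ∈ Finset.range n, ‖X i‖ ^ 2 := by
    rw [gramMatrix, Matrix.trace_smul, Matrix.trace_sum, smul_eq_mul]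
    congr 1
    refine Finset.sum_congr rfl fun i _ => ?_
    rw [Matrix.trace_vecMulVec, ← inner_eq_dotProduct, real_inner_self_eq_norm_sq]
  have hH := gramMatrix_isHermitian X n
  rw [← htr, hH.trace_eq_sum_eigenvalues]
  refine (Finset.sum_le_sum fun a _ => (h (hH.eigenvalues_mem_spectrum_real a)).2).trans ?_
  simp

end Gram

/-! ### Asymptotics of the tuning parameters and conclusion -/

lemma exists_pos_le_of_ne_zero {ι : Type*} [Finite ι] {V : Type*} [NormedAddCommGroup V]
    (f : ι → V) : ∃ ρ > 0, ∀ i, f i ≠ 0 → ρ ≤ ‖f i‖ := by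
  have h : ∀ᶠ ρ in 𝓝[>] (0 : ℝ), ∀ i, f i ≠ 0 → ρ ≤ ‖f i‖ := by
    refine eventually_all.2 fun i => ?_
    by_cases hi : f i = 0
    · exact Eventually.of_forall fun _ h => absurd hi h
    · filter_upwards [nhdsWithin_le_nhds (Iio_mem_nhds (norm_pos_iff.2 hi))] with ρ hρ _
      exact le_of_lt hρ
  obtain ⟨ρ, h1, h2⟩ := (h.and self_mem_nhdsWithin).exists
  exact ⟨ρ, h2, h1⟩

lemma sqrt_mul_rpow_neg_half {n : ℕ} (hn : 0 < n) : √(n : ℝ) * (n : ℝ) ^ (-(1 / 2) : ℝ) = 1 := by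
  have hn' : (0 : ℝ) < n := by exact_mod_cast hn
  rw [Real.sqrt_eq_rpow, ← Real.rpow_add hn']
  norm_num

lemma eventually_penalty_small {γ : ℝ} {μ₁ μ₂ : ℕ → ℝ≥0} (h₁ : TuningCondition γ μ₁)
    (h₂ : TuningCondition γ μ₂) (a b : ℝ) :
    ∀ᶠ n : ℕ in atTop, a * μ₁ n + b * μ₂ n ≤ √n := by
  have h := (h₁.small.const_mul a).add (h₂.small.const_mul b)
  rw [mul_zero, mul_zero, add_zero] at h
  filter_upwards [h.eventually_le_const zero_lt_one, eventually_gt_atTop 0] with n hn hn0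
  have h3 := sqrt_mul_rpow_neg_half hn0
  calc a * μ₁ n + b * μ₂ n
      = √(n : ℝ) * (a * ((n : ℝ) ^ (-(1 / 2) : ℝ) * μ₁ n)
        + b * ((n : ℝ) ^ (-(1 / 2) : ℝ) * μ₂ n)) := by
        linear_combination (-(a * μ₁ n + b * μ₂ n)) * h3
    _ ≤ √(n : ℝ) * 1 := by gcongr
    _ = √n := mul_one _

lemma eventually_penalty_large {γ : ℝ} {μ₁ μ₂ : ℕ → ℝ≥0} (h₁ : TuningCondition γ μ₁)
    (h₂ : TuningCondition γ μ₂) (b L : ℝ) {K : ℝ} (hK : 0 < K) :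
    ∀ᶠ n : ℕ in atTop, √n * L + b * μ₂ n < μ₁ n * (K / √n) ^ (-γ) := by
  have h := h₁.large.const_mul_atTop (Real.rpow_pos_of_pos hK (-γ))
  -- The excess 1 over L, multiplied by √n, absorbs the term b μ₂ ≤ √n.
  filter_upwards [h.eventually_gt_atTop (L + 1), eventually_penalty_small h₁ h₂ 0 b,
    eventually_gt_atTop 0] with n hn hb hn0
  have hn' : (0 : ℝ) < n := by exact_mod_cast hn0
  have hs : 0 < √(n : ℝ) := Real.sqrt_pos.2 hn'
  have heq : (K / √n) ^ (-γ) = √n * (K ^ (-γ) * (n : ℝ) ^ ((γ - 1) / 2)) := by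
    rw [Real.div_rpow hK.le hs.le, Real.rpow_neg hs.le, div_inv_eq_mul, Real.sqrt_eq_rpow,
      ← Real.rpow_mul hn'.le, mul_left_comm, ← Real.rpow_add hn']
    congr 2
    ring
  rw [heq]
  nlinarith [mul_lt_mul_of_pos_left hn hs]

lemma DesignAssumption.eventually_norm_le {p d : ℕ} (hp : 0 < p) {X : ℕ → GroupedVec p d}
    (hX : DesignAssumption X) {η : ℝ} (hη : 0 < η) :
    ∀ᶠ n : ℕ in atTop, ∀ i < n, ‖(√(n : ℝ))⁻¹ • X i‖ ≤ η := by
  filter_upwards [hX.max_norm.eventually_le_const hη] with n hn i hi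
  refine le_trans ?_ hn
  rw [norm_smul, ← Real.sqrt_eq_rpow]
  have h1 : ‖X i‖ ≤ ⨆ i : Fin n, ‖X i‖ :=
    le_ciSup (f := fun i : Fin n => ‖X i‖) (Set.finite_range _).bddAbove ⟨i, hi⟩
  have h2 : ‖(√(n : ℝ))⁻¹‖ ≤ √((p : ℝ) / n) := by
    rw [Real.norm_of_nonneg (by positivity), ← Real.sqrt_inv]
    refine Real.sqrt_le_sqrt ?_
    rw [div_eq_mul_inv]
    exact le_mul_of_one_le_left (by positivity) (by exact_mod_cast hp)
  gcongr

theorem theorem2 {Ω : Type*} [MeasurableSpace Ω] (P : Measure Ω) [IsProbabilityMeasure P]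
    (p d : ℕ) (τ γ : ℝ) (hτ : τ ∈ Set.Ioo (0 : ℝ) 1) (hγ : 0 < γ)
    -- the deterministic design, the true parameter, the errors, and the model
    (X : ℕ → GroupedVec p d) (β₀ : GroupedVec p d) (ε Y : ℕ → Ω → ℝ) (f : ℝ → ℝ)
    (hY : ∀ i ω, Y i ω = ∑ j : Fin p, ⟪X i j, β₀ j⟫ + ε i ω)
    (hε : ErrorAssumption P τ ε f) (hX : DesignAssumption X)
    -- the tuning parameters
    (μ₁ μ₂ : ℕ → ℝ≥0) (hμ₁ : TuningCondition γ μ₁) (hμ₂ : TuningCondition γ μ₂)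
    -- the quantile estimator, any minimizer of the quantile process
    (βtilde : ℕ → Ω → GroupedVec p d) (hmeas_tilde : ∀ n, Measurable (βtilde n))
    (hβtilde : ∀ n ω, IsMinOn (quantileProcess τ X (fun i => Y i ω) n) Set.univ (βtilde n ω))
    -- the adaptive fused group LASSO quantile estimator, any minimizer of the penalized process
    (βhat : ℕ → Ω → GroupedVec p d) (hmeas_hat : ∀ n, Measurable (βhat n))
    (hβhat : ∀ n ω, IsMinOn
      (penalizedProcess τ γ X (fun i => Y i ω) n (μ₁ n) (μ₂ n) (βtilde n ω)) Set.univ (βhat n ω)) :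
    Tendsto (fun n => P {ω | activeGroups (βhat n ω) = activeGroups β₀}) atTop (𝓝 1) := by
  rcases Nat.eq_zero_or_pos p with rfl | hp
  · have : ∀ n, {ω | activeGroups (βhat n ω) = activeGroups β₀} = Set.univ := fun n =>
      Set.eq_univ_of_forall fun ω => Subsingleton.elim _ _
    simp only [this, measure_univ]
    exact tendsto_const_nhds
  set ν : Measure ℝ := volume.withDensity fun x => ENNReal.ofReal (f x) with hν
  have hνprob : IsProbabilityMeasure ν := by
    rw [hν, ← hε.law 0]
    exact Measure.isProbabilityMeasure_map (hε.measurable 0).aemeasurable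
  have hscore : ∫ e, score τ e ∂ν = 0 := by
    refine integral_score_eq_zero (withDensity_absolutelyContinuous _ _ Real.volume_singleton) ?_
    rw [hν, ← hε.law 0]
    exact hε.quantile 0
  obtain ⟨c, C, δ, hc, hC, hδ, hmass⟩ : ∃ c C δ : ℝ, 0 < c ∧ 0 < C ∧ 0 < δ ∧
      LinearMassAtZero ν c C δ :=
    withDensity_linearMassAtZero hε.density_continuous.self_of_nhds hε.density_pos.self_of_nhds
  obtain ⟨m₀, M₀, hm₀, hmM, hspec⟩ := hX.eigenvalues
  obtain ⟨ρ₁, hρ₁, hactive⟩ := exists_pos_le_of_ne_zero fun j => β₀ j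
  obtain ⟨ρ₂, hρ₂, hdiff⟩ := exists_pos_le_of_ne_zero fun q : Fin p × Fin p => β₀ q.1 - β₀ q.2
  set ρ := min ρ₁ ρ₂
  have hρ : 0 < ρ := lt_min hρ₁ hρ₂
  have hlow : ∀ᶠ n : ℕ in atTop, ∀ u : GroupedVec p d,
      m₀ * ‖u‖ ^ 2 ≤ ∑ i ∈ Finset.range n, ⟪(√(n : ℝ))⁻¹ • X i, u⟫ ^ 2 := by
    filter_upwards [hspec] with n hn u
    refine (le_sum_inner_sq_of_spectrum hn u).trans (le_of_eq ?_)
    rw [Finset.mul_sum]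
    refine Finset.sum_congr rfl fun i _ => ?_
    rw [real_inner_smul_left, mul_pow, inv_pow, Real.sq_sqrt (Nat.cast_nonneg n)]
  -- The + 1 keeps the bound positive when d = 0.
  have hup : ∀ᶠ n : ℕ in atTop,
      ∑ i ∈ Finset.range n, ‖(√(n : ℝ))⁻¹ • X i‖ ^ 2 ≤ (p * d : ℕ) * M₀ + 1 := by
    filter_upwards [hspec] with n hn
    refine le_trans (le_of_eq ?_) ((sum_norm_sq_le_of_spectrum hn).trans (by linarith))
    rw [Finset.mul_sum]
    refine Finset.sum_congr rfl fun i _ => ?_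
    rw [norm_smul, mul_pow, Real.norm_of_nonneg (by positivity), inv_pow,
      Real.sq_sqrt (Nat.cast_nonneg n)]
  have hM₀ : 0 < M₀ := hm₀.trans_le hmM
  rw [← ENNReal.tendsto_toReal_iff (fun n => measure_ne_top P _) ENNReal.one_ne_top]
  refine tendsto_order.2 ⟨fun a ha => ?_, fun a ha => Eventually.of_forall fun n => ?_⟩
  swap
  · exact (measureReal_le_one (μ := P)).trans_lt ha
  rw [ENNReal.toReal_one] at ha
  obtain ⟨K, hK, L, hev⟩ := exists_local_event hτ hε.measurable hε.indep hε.law hscore hmass hc hC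
    hδ (fun n i => (√(n : ℝ))⁻¹ • X i) hm₀ (by positivity) hlow hup
    (fun η hη => hX.eventually_norm_le hp hη) (κ := (1 - a) / 2) (by linarith)
  have hKn : ∀ᶠ n : ℕ in atTop, 2 * (K / √(n : ℝ)) ≤ ρ / 2 := by
    have h1 : Tendsto (fun n : ℕ => 2 * (K / √(n : ℝ))) atTop (𝓝 (2 * 0)) :=
      ((Real.tendsto_sqrt_atTop.comp tendsto_natCast_atTop_atTop).const_div_atTop K).const_mul 2
    exact h1.eventually_le_const (by rw [mul_zero]; positivity)
  set D := (ρ / 2) ^ (-γ) with hD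
  filter_upwards [hev, hKn, eventually_gt_atTop 0,
    eventually_penalty_small hμ₁ hμ₂ (p * D) (2 * p ^ 2 * D),
    eventually_penalty_large hμ₁ hμ₂ (2 * p ^ 2 * D) L hK] with n hA hn1 hn0 hsm hlg
  obtain ⟨A, hAκ, hA⟩ := hA
  have hsub : A ⊆ {ω | activeGroups (βhat n ω) = activeGroups β₀} := fun ω hω =>
    activeGroups_eq_of_local hτ hγ (e := fun i => ε i ω)
      (fun i => by rw [hY i ω, PiLp.inner_apply]) hn0 hK (hA ω hω).1 (hA ω hω).2 hρ hD
      (fun j hj => (min_le_left _ _).trans (hactive j hj))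
      (fun i j hij => (min_le_right _ _).trans (hdiff (i, j) (sub_ne_zero.2 hij)))
      hn1 hsm hlg (hβtilde n ω) (hβhat n ω)
  -- Subadditivity suffices, so the event need not be known to be measurable.
  have h1 : (1 : ℝ) ≤ P.real A + P.real Aᶜ := by
    have := measureReal_union_le (μ := P) A Aᶜ
    rwa [Set.union_compl_self, probReal_univ] at this
  have h2 : P.real A ≤ (P {ω | activeGroups (βhat n ω) = activeGroups β₀}).toReal :=
    measureReal_mono hsub
  linarith
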